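/- Let $\mathcal{N}=\mathcal{N}^{A'\to B}$ be a quantum channel, i.e. a completely positive trace-preserving (CPTP) map $\mathcal{B}(\mathcal{H}_{A'})\to\mathcal{B}(\mathcal{H}_B)$ with $\mathcal{H}_{A'},\mathcal{H}_B$ finite-dimensional and $\mathcal{H}_{A'}\neq 0$. For $d\ge 1$ let $|\Phi_d\rangle=\frac{1}{\sqrt d}\sum_{i=1}^d|i\rangle\otimes|i\rangle$ and $\Phi_d=|\Phi_d\rangle\langle\Phi_d|$. For $m\ge 1$, an entanglement-assisted code of dimension $m$ consists of an integer $d\ge 1$ and two CPTP maps, an encoding $\mathcal{E}^{A_0A_1\to A'}$ and a decoding $\mathcal{D}^{BB_1\to A_0}$, where $\mathcal{H}_{A_0}=\mathbb{C}^m$ and $\mathcal{H}_{A_1}=\mathcal{H}_{B_1}=\mathbb{C}^d$. Its overall map $\mathcal{T}:\mathcal{B}(\mathbb{C}^m)\to\mathcal{B}(\mathbb{C}^m)$ is $$\mathcal{T}=\mathcal{D}\circ(\mathcal{N}\otimes\mathrm{id}_{B_1})\circ\widetilde{\mathcal{E}},\qquad \widetilde{\mathcal{E}}(\rho)=(\mathcal{E}\otimes\mathrm{id}_{B_1})(\rho^{A_0}\otimes\Phi_d^{A_1B_1}).$$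 Put $$F_e(\tau,\mathcal{T})=\langle\Phi_m|(\mathrm{id}\otimes\mathcal{T})(\Phi_m)|\Phi_m\rangle,\qquad F_{\min}(\mathcal{T})=\min_{\|\varphi\|=1}F^2\big(|\varphi\rangle\langle\varphi|,\mathcal{T}(|\varphi\rangle\langle\varphi|)\big),$$ where $F(\rho,\sigma)=\operatorname{tr}\sqrt{\sqrt\rho\,\sigma\sqrt\rho}$; $F_e(\tau,\mathcal T)$ is the entanglement fidelity of the completely mixed state $\tau$ on $\mathbb{C}^m$. Let $\mathbf{F_e}(\mathcal{N},m)$ and $\mathbf{F}_{\min}(\mathcal{N},m)$ be the suprema of $F_e(\tau,\mathcal{T})$ and of $F_{\min}(\mathcal{T})$, respectively, over all entanglement-assisted codes of dimension $m$ (with $d$ arbitrary). For $\varepsilon>0$ define the one-shot entanglement-assisted entanglement transmission capacity and the one-shot entanglement-assisted quantum capacity by $$E^{(1)}_{\mathrm{ea},\varepsilon}(\mathcal{N})=\sup\{\log_2 m: m\ge1,\ \mathbf{F_e}(\mathcal{N},m)\ge 1-\varepsilon\},\qquad Q^{(1)}_{\mathrm{ea},\varepsilon}(\mathcal{N})=\sup\{\log_2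 m: m\ge1,\ \mathbf{F}_{\min}(\mathcal{N},m)\ge 1-\varepsilon\},$$ with values in the extended reals (when $\varepsilon\ge1$ the condition on $m$ is void and the supremum is $+\infty$). Then for every $0<\varepsilon<1$, $$E^{(1)}_{\mathrm{ea},\varepsilon}(\mathcal{N})-1\ \le\ Q^{(1)}_{\mathrm{ea},2\varepsilon}(\mathcal{N})\ \le\ E^{(1)}_{\mathrm{ea},4\varepsilon}(\mathcal{N}).$$ -/

import Mathlib

namespace EAQ

noncomputable section

open scoped Matrix Kronecker ComplexOrder MatrixOrder

/-- The rank-one operator `|ψ⟩⟨ψ|`. -/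
def ketbra {n : Type*} (ψ : n → ℂ) : Matrix n n ℂ :=
  Matrix.vecMulVec ψ (star ψ)

/-- The number `⟨ψ|M|ψ⟩` (its real part, it being real for Hermitian `M`). -/
def expectation {n : Type*} [Fintype n] (M : Matrix n n ℂ) (ψ : n → ℂ) : ℝ :=
  (star ψ ⬝ᵥ (M *ᵥ ψ)).re

/-- `ψ` is a unit vector of the Hilbert space `ℂⁿ`. -/
def IsUnitVector {n : Type*} [Fintype n] (ψ : n → ℂ) : Prop :=
  ∑ i, ‖ψ i‖ ^ 2 = 1

/-- The completely mixed state `𝟙 / m` on `ℂᵐ`. -/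
def mixedState (m : ℕ) : Matrix (Fin m) (Fin m) ℂ :=
  ((m : ℂ))⁻¹ • (1 : Matrix (Fin m) (Fin m) ℂ)

/-- The maximally entangled unit vector `(1/√d) ∑ᵢ |i⟩ ⊗ |i⟩` in `ℂᵈ ⊗ ℂᵈ`. -/
def maxEntangled (d : ℕ) : Fin d × Fin d → ℂ :=
  fun p => if p.1 = p.2 then (((Real.sqrt d)⁻¹ : ℝ) : ℂ) else 0

/-- The partial trace over the first tensor factor. -/
def traceLeft {r q : Type*} [Fintype r] (M : Matrix (r × q) (r × q) ℂ) : Matrix q q ℂ :=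
  Matrix.of fun x y => ∑ i, M (i, x) (i, y)

/-- The vector `Ψ` in `R ⊗ Q` purifies the state `ρ` on `Q`. -/
def IsPurification {r q : Type*} [Fintype r] (Ψ : r × q → ℂ) (ρ : Matrix q q ℂ) : Prop :=
  traceLeft (ketbra Ψ) = ρ

/-- The maximally entangled vector purifies the completely mixed state. -/
theorem isPurification_maxEntangled (m : ℕ) :
    IsPurification (maxEntangled m) (mixedState m) := by
  ext x y
  have h : ((((Real.sqrt m)⁻¹ : ℝ) : ℂ)) * (((Real.sqrt m)⁻¹ : ℝ) : ℂ) = (m : ℂ)⁻¹ := by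
    rw [← Complex.ofReal_mul, ← mul_inv, Real.mul_self_sqrt (Nat.cast_nonneg m)]
    simp
  rw [traceLeft, mixedState, Matrix.of_apply, Finset.sum_eq_single x]
  · by_cases hxy : x = y
    · subst hxy
      simpa [ketbra, maxEntangled, Matrix.vecMulVec_apply] using h
    · simp [ketbra, maxEntangled, Matrix.vecMulVec_apply, hxy]
  · intro i _ hi
    simp [ketbra, maxEntangled, Matrix.vecMulVec_apply, hi]
  · simp

/-- The map `id ⊗ Φ` on operators on `R ⊗ A`. -/
def idTensor (r : Type*) {a b : Type*} (Φ : Matrix a a ℂ →ₗ[ℂ] Matrix b b ℂ) :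
    Matrix (r × a) (r × a) ℂ →ₗ[ℂ] Matrix (r × b) (r × b) ℂ where
  toFun M := Matrix.of fun p q => Φ (Matrix.of fun x y => M (p.1, x) (q.1, y)) p.2 q.2
  map_add' M M' := by
    ext p q
    exact congrFun (congrFun (Φ.map_add (Matrix.of fun x y => M (p.1, x) (q.1, y))
      (Matrix.of fun x y => M' (p.1, x) (q.1, y))) p.2) q.2
  map_smul' c M := by
    ext p q
    exact congrFun (congrFun (Φ.map_smul c (Matrix.of fun x y => M (p.1, x) (q.1, y))) p.2) q.2

/-- The map `Φ ⊗ id` on operators on `A ⊗ S`. -/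
def tensorId (s : Type*) {a b : Type*} (Φ : Matrix a a ℂ →ₗ[ℂ] Matrix b b ℂ) :
    Matrix (a × s) (a × s) ℂ →ₗ[ℂ] Matrix (b × s) (b × s) ℂ where
  toFun M := Matrix.of fun p q => Φ (Matrix.of fun x y => M (x, p.2) (y, q.2)) p.1 q.1
  map_add' M M' := by
    ext p q
    exact congrFun (congrFun (Φ.map_add (Matrix.of fun x y => M (x, p.2) (y, q.2))
      (Matrix.of fun x y => M' (x, p.2) (y, q.2))) p.1) q.1
  map_smul' c M := by
    ext p q
    exact congrFun (congrFun (Φ.map_smul c (Matrix.of fun x y => M (x, p.2) (y, q.2))) p.1) q.1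

/-- Quantum channels: completely positive trace-preserving linear maps. -/
structure IsChannel {a b : Type*} [Fintype a] [Fintype b]
    (Φ : Matrix a a ℂ →ₗ[ℂ] Matrix b b ℂ) : Prop where
  completely_positive : ∀ (k : ℕ) (M : Matrix (Fin k × a) (Fin k × a) ℂ),
    M.PosSemidef → (idTensor (Fin k) Φ M).PosSemidef
  trace_preserving : ∀ M : Matrix a a ℂ, (Φ M).trace = M.trace

/-- The fidelity `F(ρ, σ) = tr √(√ρ σ √ρ)`. -/
def fidelity {n : Type*} [Fintype n] [DecidableEq n] (ρ σ : Matrix n n ℂ) : ℝ :=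
  (CFC.sqrt (CFC.sqrt ρ * σ * CFC.sqrt ρ)).trace.re

/-- The entanglement fidelity `⟨Ψ|(id ⊗ T)(|Ψ⟩⟨Ψ|)|Ψ⟩` of the map `T` with respect to the
state purified by `Ψ`. -/
def entanglementFidelity {r q : Type*} [Fintype r] [Fintype q] (Ψ : r × q → ℂ)
    (T : Matrix q q ℂ →ₗ[ℂ] Matrix q q ℂ) : ℝ :=
  expectation (idTensor r T (ketbra Ψ)) Ψ

/-- The minimum over all unit vectors `φ` of `F²(|φ⟩⟨φ|, T(|φ⟩⟨φ|))`. -/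
def minFidelity {n : Type*} [Fintype n] [DecidableEq n]
    (T : Matrix n n ℂ →ₗ[ℂ] Matrix n n ℂ) : ℝ :=
  sInf {f : ℝ | ∃ φ : n → ℂ, IsUnitVector φ ∧ f = fidelity (ketbra φ) (T (ketbra φ)) ^ 2}

/-- The map `ρ ↦ (E ⊗ id)(ρ ⊗ |Φ⟩⟨Φ|)` from `A₀` to `A' ⊗ B₁` that an encoding `E` of
`A₀ ⊗ A₁` into `A'` induces when `A₁` is half of the maximally entangled state on `A₁ ⊗ B₁`. -/
def assistedEncoding {a : Type*} {m d : ℕ}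
    (E : Matrix (Fin m × Fin d) (Fin m × Fin d) ℂ →ₗ[ℂ] Matrix a a ℂ) :
    Matrix (Fin m) (Fin m) ℂ →ₗ[ℂ] Matrix (a × Fin d) (a × Fin d) ℂ where
  toFun ρ := tensorId (Fin d) E
    ((ρ ⊗ₖ ketbra (maxEntangled d)).submatrix (Equiv.prodAssoc _ _ _) (Equiv.prodAssoc _ _ _))
  map_add' ρ σ := by
    rw [Matrix.add_kronecker, ← map_add]
    rfl
  map_smul' c ρ := by
    rw [Matrix.smul_kronecker, RingHom.id_apply, ← map_smul]
    rfl

/-- The overall map from `A₀` to `A₀` of the protocol with encoding `E`, channel `N` and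
decoding `D`, assisted by a maximally entangled state of Schmidt rank `d`. -/
def protocol {a b : Type*} {m d : ℕ} (N : Matrix a a ℂ →ₗ[ℂ] Matrix b b ℂ)
    (E : Matrix (Fin m × Fin d) (Fin m × Fin d) ℂ →ₗ[ℂ] Matrix a a ℂ)
    (D : Matrix (b × Fin d) (b × Fin d) ℂ →ₗ[ℂ] Matrix (Fin m) (Fin m) ℂ) :
    Matrix (Fin m) (Fin m) ℂ →ₗ[ℂ] Matrix (Fin m) (Fin m) ℂ :=
  D ∘ₗ tensorId (Fin d) N ∘ₗ assistedEncoding E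

/-- The optimal entanglement fidelity with respect to the completely mixed state on `ℂᵐ`, over
all codes assisted by a maximally entangled state of any Schmidt rank. -/
def transmissionFidelity {a b : Type*} [Fintype a] [Fintype b]
    (N : Matrix a a ℂ →ₗ[ℂ] Matrix b b ℂ) (m : ℕ) : ℝ :=
  sSup {f : ℝ | ∃ d : ℕ, 0 < d ∧
    ∃ (E : Matrix (Fin m × Fin d) (Fin m × Fin d) ℂ →ₗ[ℂ] Matrix a a ℂ)
      (D : Matrix (b × Fin d) (b × Fin d) ℂ →ₗ[ℂ] Matrix (Fin m) (Fin m) ℂ),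
      IsChannel E ∧ IsChannel D ∧
        f = entanglementFidelity (maxEntangled m) (protocol N E D)}

/-- The optimal minimum output fidelity on `ℂᵐ`, over all codes assisted by a maximally
entangled state of any Schmidt rank. -/
def minOutputFidelity {a b : Type*} [Fintype a] [Fintype b]
    (N : Matrix a a ℂ →ₗ[ℂ] Matrix b b ℂ) (m : ℕ) : ℝ :=
  sSup {f : ℝ | ∃ d : ℕ, 0 < d ∧
    ∃ (E : Matrix (Fin m × Fin d) (Fin m × Fin d) ℂ →ₗ[ℂ] Matrix a a ℂ)
      (D : Matrix (b × Fin d) (b × Fin d) ℂ →ₗ[ℂ] Matrix (Fin m) (Fin m) ℂ),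
      IsChannel E ∧ IsChannel D ∧ f = minFidelity (protocol N E D)}

/-- The one-shot `ε`-error entanglement-assisted entanglement transmission capacity, in qubits.
It takes values in the extended reals, so that an unbounded set of rates has supremum `⊤`. -/
def entanglementTransmissionCapacity {a b : Type*} [Fintype a] [Fintype b]
    (N : Matrix a a ℂ →ₗ[ℂ] Matrix b b ℂ) (ε : ℝ) : EReal :=
  sSup {r : EReal | ∃ m : ℕ, 0 < m ∧ 1 - ε ≤ transmissionFidelity N m ∧
    r = ((Real.logb 2 m : ℝ) : EReal)}

/-- The one-shot `ε`-error entanglement-assisted quantum capacity, in qubits. -/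
def quantumCapacity {a b : Type*} [Fintype a] [Fintype b]
    (N : Matrix a a ℂ →ₗ[ℂ] Matrix b b ℂ) (ε : ℝ) : EReal :=
  sSup {r : EReal | ∃ m : ℕ, 0 < m ∧ 1 - ε ≤ minOutputFidelity N m ∧
    r = ((Real.logb 2 m : ℝ) : EReal)}

end

end EAQ

namespace EAQ

noncomputable section

open scoped Matrix Kronecker ComplexOrder MatrixOrder
open Matrix Finset

/-! ### Quadratic forms of positive semidefinite matrices -/

/-! Everything reduces to comparing, for one channel `T` on `ℂᵐ`, the entanglement fidelity `F_e`
with the pure-state fidelities `f(u) = ⟨u|T(|u⟩⟨u|)|u⟩`. Both are values of the quadratic form of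
the Choi matrix: `f(u)` at `ū ⊗ u`, and `m² F_e` at `∑ᵢ |i⟩ ⊗ |i⟩`, which equals `∑ᵢ ūᵢ ⊗ uᵢ` for
every orthonormal basis.

Lower bound on the quantum capacity. By Jensen, `F_e` is at most the mean of `f` over any
orthonormal basis. If `F_e ≥ 1 - η`, Markov's inequality leaves at most `m/2` vectors of a basis
bad, meaning `f < 1 - 2η`. In a basis with the most bad vectors, no unit vector in the span of the
good ones is bad: it could replace a good one and give a larger count (`exists_isometry_of_sum_le`).
Restricting the code to `⌈m/2⌉` good vectors doubles the error and costs at most one qubit.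

Upper bound. Averaging `f` over vectors whose coordinates are cube roots of unity computes fourth
moments exactly and gives `(m + 1) F_min ≤ m F_e + 1`, hence `F_e ≥ 2 F_min - 1`
(`IsChannel.minFidelity_le_entanglementFidelity`). The error doubles once more, from `2ε` to `4ε`.
-/

theorem expectation_nonneg {n : Type*} [Fintype n] {M : Matrix n n ℂ} (hM : M.PosSemidef)
    (ψ : n → ℂ) : 0 ≤ expectation M ψ :=
  (Complex.nonneg_iff.mp (hM.dotProduct_mulVec_nonneg ψ)).1

theorem ketbra_posSemidef {n : Type*} [Fintype n] (ψ : n → ℂ) : (ketbra ψ).PosSemidef :=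
  posSemidef_vecMulVec_self_star ψ

theorem ketbra_conjTranspose {n : Type*} (ψ : n → ℂ) : (ketbra ψ)ᴴ = ketbra ψ := by
  ext i j
  simp [ketbra, vecMulVec_apply, mul_comm]

theorem ketbra_smul {n : Type*} (c : ℝ) (ψ : n → ℂ) :
    ketbra (fun i => (c : ℂ) * ψ i) = ((c ^ 2 : ℝ) : ℂ) • ketbra ψ := by
  ext i j
  simp [ketbra, vecMulVec_apply]
  ring

theorem expectation_eq_sum {n : Type*} [Fintype n] (M : Matrix n n ℂ) (ψ : n → ℂ) :
    expectation M ψ = (∑ i, ∑ j, star (ψ i) * M i j * ψ j).re := by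
  simp [expectation, dotProduct, mulVec, Finset.mul_sum, mul_assoc]

theorem expectation_smul_vec {n : Type*} [Fintype n] (M : Matrix n n ℂ) (c : ℝ) (ψ : n → ℂ) :
    expectation M (fun i => (c : ℂ) * ψ i) = c ^ 2 * expectation M ψ := by
  rw [expectation_eq_sum, expectation_eq_sum, ← Complex.re_ofReal_mul, Finset.mul_sum]
  congr 1
  refine Finset.sum_congr rfl fun i _ => ?_
  rw [Finset.mul_sum]
  refine Finset.sum_congr rfl fun j _ => ?_
  simp
  ring

theorem expectation_smul {n : Type*} [Fintype n] (M : Matrix n n ℂ) (c : ℝ) (ψ : n → ℂ) :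
    expectation ((c : ℂ) • M) ψ = c * expectation M ψ := by
  simp [expectation, smul_mulVec]

theorem expectation_add {n : Type*} [Fintype n] (M M' : Matrix n n ℂ) (ψ : n → ℂ) :
    expectation (M + M') ψ = expectation M ψ + expectation M' ψ := by
  simp [expectation, add_mulVec]

theorem isUnitVector_iff {n : Type*} [Fintype n] (ψ : n → ℂ) :
    IsUnitVector ψ ↔ star ψ ⬝ᵥ ψ = 1 := by
  have h : star ψ ⬝ᵥ ψ = ((∑ i, ‖ψ i‖ ^ 2 : ℝ) : ℂ) := by
    simp [dotProduct, ← Complex.conj_mul']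
  rw [h, IsUnitVector]
  norm_cast

theorem ketbra_trace {n : Type*} [Fintype n] {ψ : n → ℂ} (h : IsUnitVector ψ) :
    (ketbra ψ).trace = 1 := by
  rw [isUnitVector_iff] at h
  rw [ketbra, trace_vecMulVec, dotProduct_comm, h]

theorem ketbra_mul_mul {n : Type*} [Fintype n] (M : Matrix n n ℂ) (ψ : n → ℂ) :
    ketbra ψ * M * ketbra ψ = (star ψ ⬝ᵥ (M *ᵥ ψ)) • ketbra ψ := by
  rw [ketbra, Matrix.mul_assoc, mul_vecMulVec, vecMulVec_mul_vecMulVec]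
  ext i j
  simp [vecMulVec_apply]
  ring

theorem ketbra_mul_self {n : Type*} [Fintype n] {ψ : n → ℂ} (h : IsUnitVector ψ) :
    ketbra ψ * ketbra ψ = ketbra ψ := by
  classical
  have := ketbra_mul_mul 1 ψ
  rwa [Matrix.mul_one, one_mulVec, (isUnitVector_iff ψ).1 h, one_smul] at this

theorem trace_mul_ketbra {n : Type*} [Fintype n] (M : Matrix n n ℂ) (ψ : n → ℂ) :
    (M * ketbra ψ).trace = star ψ ⬝ᵥ (M *ᵥ ψ) := by
  rw [ketbra, mul_vecMulVec, trace_vecMulVec, dotProduct_comm]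

theorem expectation_le_trace {n : Type*} [Fintype n] {M : Matrix n n ℂ} (hM : M.PosSemidef)
    {ψ : n → ℂ} (h : IsUnitVector ψ) : expectation M ψ ≤ M.trace.re := by
  classical
  -- Compressing `M` to the orthogonal complement of `ψ` leaves a positive matrix of trace `tr M -
  -- ⟨ψ|M|ψ⟩`.
  have h1 := (hM.mul_mul_conjTranspose_same (1 - ketbra ψ)).trace_nonneg
  rw [conjTranspose_sub, conjTranspose_one, ketbra_conjTranspose, trace_mul_cycle,
    trace_mul_comm] at h1
  have h2 : (1 - ketbra ψ) * (1 - ketbra ψ) = 1 - ketbra ψ := by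
    simp [Matrix.mul_sub, Matrix.sub_mul, ketbra_mul_self h]
  rw [h2, Matrix.mul_sub, Matrix.mul_one, trace_sub, trace_mul_ketbra] at h1
  have := (Complex.nonneg_iff.mp h1).1
  simpa [expectation] using this

/-- A rank-one projection `P` is its own square root, and `P σ P` is a nonnegative multiple of `P`,
so both roots are explicit. -/
theorem fidelity_ketbra_sq {n : Type*} [Fintype n] [DecidableEq n] {σ : Matrix n n ℂ}
    (hσ : σ.PosSemidef) {φ : n → ℂ} (h : IsUnitVector φ) :
    fidelity (ketbra φ) σ ^ 2 = expectation σ φ := by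
  have hP : (0 : Matrix n n ℂ) ≤ ketbra φ := (ketbra_posSemidef φ).nonneg
  have h1 : CFC.sqrt (ketbra φ) = ketbra φ := CFC.sqrt_unique (ketbra_mul_self h) hP
  have hs : star φ ⬝ᵥ (σ *ᵥ φ) = ((expectation σ φ : ℝ) : ℂ) :=
    Complex.eq_re_of_ofReal_le (r := 0) (by simpa using hσ.dotProduct_mulVec_nonneg φ)
  have h2 : CFC.sqrt (((expectation σ φ : ℝ) : ℂ) • ketbra φ)
      = ((Real.sqrt (expectation σ φ) : ℝ) : ℂ) • ketbra φ := by
    refine CFC.sqrt_unique ?_ ?_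
    · rw [Matrix.smul_mul, Matrix.mul_smul, smul_smul, ketbra_mul_self h, ← Complex.ofReal_mul,
        Real.mul_self_sqrt (expectation_nonneg hσ φ)]
    · exact ((ketbra_posSemidef φ).smul
        (Complex.zero_le_real.2 (Real.sqrt_nonneg _))).nonneg
  rw [fidelity, h1, ketbra_mul_mul, hs, h2, trace_smul, ketbra_trace h]
  simp [Real.sq_sqrt (expectation_nonneg hσ φ)]

/-- Jensen's inequality for the quadratic form of a positive semidefinite matrix. -/
theorem expectation_sum_le {n ι : Type*} [Fintype n] [Fintype ι] {M : Matrix n n ℂ}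
    (hM : M.PosSemidef) (w : ι → n → ℂ) :
    expectation M (∑ i, w i) ≤ Fintype.card ι * ∑ i, expectation M (w i) := by
  -- Positivity at `w i - w j` bounds the symmetrised cross term; summing over all pairs gives the
  -- claim doubled.
  have key : ∀ i j, (star (w i) ⬝ᵥ (M *ᵥ w j)).re + (star (w j) ⬝ᵥ (M *ᵥ w i)).re
      ≤ expectation M (w i) + expectation M (w j) := fun i j => by
    have := expectation_nonneg hM (w i - w j)
    simp only [expectation, star_sub, mulVec_sub, sub_dotProduct, dotProduct_sub,
      Complex.sub_re] at this ⊢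
    linarith
  have h1 : expectation M (∑ i, w i) = ∑ i, ∑ j, (star (w i) ⬝ᵥ (M *ᵥ w j)).re := by
    simp only [expectation, star_sum, mulVec_sum, sum_dotProduct, dotProduct_sum, Complex.re_sum]
    exact Finset.sum_comm
  have h2 := Finset.sum_le_sum fun i (_ : i ∈ Finset.univ) =>
    Finset.sum_le_sum fun j (_ : j ∈ Finset.univ) => key i j
  simp only [Finset.sum_add_distrib, Finset.sum_const, Finset.card_univ, nsmul_eq_mul,
    ← Finset.mul_sum] at h2
  rw [Finset.sum_comm (f := fun i j => (star (w j) ⬝ᵥ (M *ᵥ w i)).re), ← h1] at h2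
  linarith

/-! ### Channels -/

/-- Complete positivity is stated only for references `Fin k`; reindexing extends it to any finite
reference. -/
theorem IsChannel.idTensor_posSemidef {a b r : Type*} [Fintype a] [Fintype b] [Fintype r]
    {Φ : Matrix a a ℂ →ₗ[ℂ] Matrix b b ℂ} (h : IsChannel Φ) {M : Matrix (r × a) (r × a) ℂ}
    (hM : M.PosSemidef) : (idTensor r Φ M).PosSemidef := by
  let e := (Fintype.equivFin r).symm
  have h1 := h.completely_positive _ (M.submatrix (Prod.map e id) (Prod.map e id))
    (hM.submatrix _)
  have h2 := h1.submatrix (Prod.map e.symm id)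
  convert h2 using 1
  ext p q
  simp [idTensor]

theorem IsChannel.posSemidef {a b : Type*} [Fintype a] [Fintype b]
    {Φ : Matrix a a ℂ →ₗ[ℂ] Matrix b b ℂ} (h : IsChannel Φ) {M : Matrix a a ℂ}
    (hM : M.PosSemidef) : (Φ M).PosSemidef :=
  (h.idTensor_posSemidef (r := Unit) (hM.submatrix Prod.snd)).submatrix fun x => ((), x)

theorem IsChannel.comp {a b c : Type*} [Fintype a] [Fintype b] [Fintype c]
    {Φ : Matrix a a ℂ →ₗ[ℂ] Matrix b b ℂ} {Ψ : Matrix b b ℂ →ₗ[ℂ] Matrix c c ℂ}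
    (hΨ : IsChannel Ψ) (hΦ : IsChannel Φ) : IsChannel (Ψ ∘ₗ Φ) where
  completely_positive k M hM :=
    hΨ.completely_positive k _ (hΦ.completely_positive k M hM)
  trace_preserving M := by
    rw [LinearMap.comp_apply, hΨ.trace_preserving, hΦ.trace_preserving]

/-- The spectator `s` is absorbed into the reference system, which becomes `Fin k × s`. -/
theorem IsChannel.tensorId {a b s : Type*} [Fintype a] [Fintype b] [Fintype s]
    {Φ : Matrix a a ℂ →ₗ[ℂ] Matrix b b ℂ} (h : IsChannel Φ) : IsChannel (tensorId s Φ) where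
  completely_positive k M hM :=
    (h.idTensor_posSemidef (r := Fin k × s)
      (hM.submatrix fun p : (Fin k × s) × a => (p.1.1, (p.2, p.1.2)))).submatrix
      fun p : Fin k × (b × s) => ((p.1, p.2.2), p.2.1)
  trace_preserving M := by
    have h1 : ∀ t : s, ∑ x, Φ (Matrix.of fun x y => M (x, t) (y, t)) x x
        = ∑ x, M (x, t) (x, t) := fun t =>
      h.trace_preserving (Matrix.of fun x y => M (x, t) (y, t))
    simp only [Matrix.trace, Matrix.diag, Fintype.sum_prod_type_right]
    exact Finset.sum_congr rfl fun t _ => h1 t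

theorem isUnitVector_maxEntangled {d : ℕ} (hd : 0 < d) : IsUnitVector (maxEntangled d) := by
  have hd' : (d : ℝ) ≠ 0 := by positivity
  simp only [IsUnitVector, maxEntangled, Fintype.sum_prod_type]
  simp [apply_ite, ite_pow, hd']

theorem assistedEncoding_apply {a : Type*} {m d : ℕ}
    (E : Matrix (Fin m × Fin d) (Fin m × Fin d) ℂ →ₗ[ℂ] Matrix a a ℂ)
    (ρ : Matrix (Fin m) (Fin m) ℂ) :
    assistedEncoding E ρ = EAQ.tensorId (Fin d) E ((ρ ⊗ₖ ketbra (maxEntangled d)).submatrix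
      (Equiv.prodAssoc _ _ _) (Equiv.prodAssoc _ _ _)) := rfl

theorem IsChannel.assistedEncoding {a : Type*} [Fintype a] {m d : ℕ} (hd : 0 < d)
    {E : Matrix (Fin m × Fin d) (Fin m × Fin d) ℂ →ₗ[ℂ] Matrix a a ℂ} (h : IsChannel E) :
    IsChannel (assistedEncoding E) where
  completely_positive k M hM := by
    have h1 := (hM.kronecker (ketbra_posSemidef (maxEntangled d))).submatrix
      fun p : Fin k × ((Fin m × Fin d) × Fin d) => ((p.1, p.2.1.1), (p.2.1.2, p.2.2))
    have h2 := (h.tensorId (s := Fin d)).completely_positive k _ h1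
    have h3 : idTensor (Fin k) (EAQ.assistedEncoding E) M
        = idTensor (Fin k) (EAQ.tensorId (Fin d) E) ((M ⊗ₖ ketbra (maxEntangled d)).submatrix
          (fun p : Fin k × ((Fin m × Fin d) × Fin d) => ((p.1, p.2.1.1), (p.2.1.2, p.2.2)))
          (fun p : Fin k × ((Fin m × Fin d) × Fin d) => ((p.1, p.2.1.1), (p.2.1.2, p.2.2)))) := by
      ext ⟨i, x, s⟩ ⟨j, y, t⟩
      rfl
    rw [h3]
    exact h2
  trace_preserving M := by
    have h1 : (M ⊗ₖ ketbra (maxEntangled d)).trace = M.trace := by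
      rw [trace_kronecker, ketbra_trace (isUnitVector_maxEntangled hd), mul_one]
    rw [assistedEncoding_apply, h.tensorId.trace_preserving, ← h1]
    exact Equiv.sum_comp (Equiv.prodAssoc (Fin m) (Fin d) (Fin d))
      fun p => (M ⊗ₖ ketbra (maxEntangled d)) p p

theorem IsChannel.protocol {a b : Type*} [Fintype a] [Fintype b] {m d : ℕ} (hd : 0 < d)
    {N : Matrix a a ℂ →ₗ[ℂ] Matrix b b ℂ}
    {E : Matrix (Fin m × Fin d) (Fin m × Fin d) ℂ →ₗ[ℂ] Matrix a a ℂ}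
    {D : Matrix (b × Fin d) (b × Fin d) ℂ →ₗ[ℂ] Matrix (Fin m) (Fin m) ℂ}
    (hN : IsChannel N) (hE : IsChannel E) (hD : IsChannel D) : IsChannel (protocol N E D) :=
  hD.comp (hN.tensorId.comp (hE.assistedEncoding hd))

/-- The completely positive map `M ↦ ∑ᵢ Kᵢ M Kᵢ†`. -/
def krausMap {ι a b : Type*} [Fintype ι] [Fintype a] (K : ι → Matrix b a ℂ) :
    Matrix a a ℂ →ₗ[ℂ] Matrix b b ℂ where
  toFun M := ∑ i, K i * M * (K i)ᴴ
  map_add' M M' := by simp [Matrix.mul_add, Matrix.add_mul, Finset.sum_add_distrib]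
  map_smul' c M := by simp [Finset.smul_sum]

theorem krausMap_apply {ι a b : Type*} [Fintype ι] [Fintype a] (K : ι → Matrix b a ℂ)
    (M : Matrix a a ℂ) : krausMap K M = ∑ i, K i * M * (K i)ᴴ := rfl

theorem idTensor_krausMap {ι a b r : Type*} [Fintype ι] [Fintype a] [Fintype r] [DecidableEq r]
    (K : ι → Matrix b a ℂ) (M : Matrix (r × a) (r × a) ℂ) :
    idTensor r (krausMap K) M = ∑ i, ((1 : Matrix r r ℂ) ⊗ₖ K i) * M * ((1 : Matrix r r ℂ) ⊗ₖ K i)ᴴ := by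
  ext p q
  rw [Matrix.sum_apply]
  change (krausMap K (Matrix.of fun x y => M (p.1, x) (q.1, y))) p.2 q.2 = _
  rw [krausMap_apply, Matrix.sum_apply]
  refine Finset.sum_congr rfl fun i _ => ?_
  obtain ⟨p1, p2⟩ := p
  obtain ⟨q1, q2⟩ := q
  rw [Matrix.mul_apply, Matrix.mul_apply, Fintype.sum_prod_type_right]
  simp [Matrix.mul_apply, Fintype.sum_prod_type_right, Matrix.one_apply, apply_ite, ite_mul]

theorem isChannel_krausMap {ι a b : Type*} [Fintype ι] [Fintype a] [Fintype b] [DecidableEq a]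
    (K : ι → Matrix b a ℂ) (hK : ∑ i, (K i)ᴴ * K i = 1) : IsChannel (krausMap K) where
  completely_positive k M hM := by
    rw [idTensor_krausMap]
    exact posSemidef_sum _ fun i _ => hM.mul_mul_conjTranspose_same _
  trace_preserving M := by
    rw [krausMap_apply, trace_sum]
    rw [Finset.sum_congr rfl fun i _ => trace_mul_cycle (K i) M (K i)ᴴ, ← trace_sum, ← Finset.sum_mul, hK, Matrix.one_mul]

/-! ### Entanglement fidelity and the fidelities of pure inputs -/

/-- The Choi matrix of `T`. -/
def choi {n : Type*} [DecidableEq n] (T : Matrix n n ℂ →ₗ[ℂ] Matrix n n ℂ) :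
    Matrix (n × n) (n × n) ℂ :=
  Matrix.of fun p q => T (Matrix.single p.1 q.1 1) p.2 q.2

/-- The number `⟨u|T(|u⟩⟨u|)|u⟩`. -/
def pureFidelity {n : Type*} [Fintype n] (T : Matrix n n ℂ →ₗ[ℂ] Matrix n n ℂ) (u : n → ℂ) : ℝ :=
  expectation (T (ketbra u)) u

/-- This exhibits the Choi matrix as the image of a positive matrix under `id ⊗ T`, whence its
positivity for a channel. -/
theorem choi_eq_idTensor {n : Type*} [DecidableEq n] (T : Matrix n n ℂ →ₗ[ℂ] Matrix n n ℂ) :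
    choi T = idTensor n T (ketbra fun p => if p.1 = p.2 then 1 else 0) := by
  ext p q
  have h : (Matrix.single p.1 q.1 1 : Matrix n n ℂ) = Matrix.of fun x y =>
      ketbra (fun p : n × n => if p.1 = p.2 then (1 : ℂ) else 0) (p.1, x) (q.1, y) := by
    ext x y
    by_cases h1 : p.1 = x <;> by_cases h2 : q.1 = y <;>
      simp [ketbra, vecMulVec_apply, h1, h2]
  rw [choi, Matrix.of_apply, h]
  rfl

theorem IsChannel.choi_posSemidef {n : Type*} [Fintype n] [DecidableEq n]
    {T : Matrix n n ℂ →ₗ[ℂ] Matrix n n ℂ} (h : IsChannel T) : (choi T).PosSemidef := by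
  rw [choi_eq_idTensor]
  exact h.idTensor_posSemidef (ketbra_posSemidef _)

theorem entanglementFidelity_maxEntangled {m : ℕ}
    (T : Matrix (Fin m) (Fin m) ℂ →ₗ[ℂ] Matrix (Fin m) (Fin m) ℂ) :
    entanglementFidelity (maxEntangled m) T
      = ((m : ℝ) ^ 2)⁻¹ * expectation (choi T) fun p => if p.1 = p.2 then 1 else 0 := by
  have h : maxEntangled m = fun p => (((Real.sqrt m)⁻¹ : ℝ) : ℂ) *
      (fun p : Fin m × Fin m => if p.1 = p.2 then (1 : ℂ) else 0) p := by
    ext p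
    simp [maxEntangled]
  rw [entanglementFidelity, h, ketbra_smul, map_smul, expectation_smul_vec, expectation_smul,
    ← choi_eq_idTensor, ← mul_assoc, inv_pow, Real.sq_sqrt (Nat.cast_nonneg m), sq, mul_inv]

/-- A quantity quartic in `u` becomes a quadratic form with a fixed matrix. The first factor is
conjugated because `T(|i⟩⟨j|)` carries the coefficient `uᵢ ūⱼ`. -/
theorem pureFidelity_eq_expectation_choi {n : Type*} [Fintype n] [DecidableEq n]
    (T : Matrix n n ℂ →ₗ[ℂ] Matrix n n ℂ) (u : n → ℂ) :
    pureFidelity T u = expectation (choi T) fun p => star (u p.1) * u p.2 := by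
  have h : T (ketbra u) = ∑ i, ∑ j, (u i * star (u j)) • T (Matrix.single i j 1) := by
    conv_lhs => rw [matrix_eq_sum_single (ketbra u)]
    simp only [map_sum]
    refine Finset.sum_congr rfl fun i _ => Finset.sum_congr rfl fun j _ => ?_
    rw [← map_smul, Matrix.smul_single, smul_eq_mul, mul_one]
    rfl
  rw [pureFidelity, expectation_eq_sum, expectation_eq_sum, h]
  congr 1
  simp only [Fintype.sum_prod_type, Matrix.sum_apply, Matrix.smul_apply, Finset.mul_sum,
    Finset.sum_mul, choi, Matrix.of_apply, smul_eq_mul]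
  have e1 : ∀ F : n → n → n → n → ℂ, ∑ x, ∑ y, ∑ i, ∑ j, F x y i j
      = ∑ i, ∑ x, ∑ j, ∑ y, F x y i j := fun F => by
    calc _ = ∑ x, ∑ i, ∑ j, ∑ y, F x y i j := by
          refine Finset.sum_congr rfl fun x _ => ?_
          rw [Finset.sum_comm]
          exact Finset.sum_congr rfl fun i _ => Finset.sum_comm
      _ = _ := Finset.sum_comm
  rw [e1]
  refine Finset.sum_congr rfl fun i _ => Finset.sum_congr rfl fun x _ =>
    Finset.sum_congr rfl fun j _ => Finset.sum_congr rfl fun y _ => ?_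
  simp
  ring

theorem IsChannel.pureFidelity_nonneg {n : Type*} [Fintype n]
    {T : Matrix n n ℂ →ₗ[ℂ] Matrix n n ℂ} (h : IsChannel T) (u : n → ℂ) : 0 ≤ pureFidelity T u :=
  expectation_nonneg (h.posSemidef (ketbra_posSemidef u)) u

theorem IsChannel.pureFidelity_le_one {n : Type*} [Fintype n]
    {T : Matrix n n ℂ →ₗ[ℂ] Matrix n n ℂ} (h : IsChannel T) {u : n → ℂ} (hu : IsUnitVector u) :
    pureFidelity T u ≤ 1 := by
  have := expectation_le_trace (h.posSemidef (ketbra_posSemidef u)) hu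
  rwa [h.trace_preserving, ketbra_trace hu, Complex.one_re] at this

theorem IsChannel.entanglementFidelity_nonneg {m : ℕ}
    {T : Matrix (Fin m) (Fin m) ℂ →ₗ[ℂ] Matrix (Fin m) (Fin m) ℂ} (h : IsChannel T) :
    0 ≤ entanglementFidelity (maxEntangled m) T :=
  expectation_nonneg (h.idTensor_posSemidef (ketbra_posSemidef _)) _

/-- The entanglement fidelity with respect to the completely mixed state is at most the average
fidelity of the vectors of an orthonormal basis. -/
theorem IsChannel.entanglementFidelity_le_sum {m : ℕ} (hm : 0 < m)
    {T : Matrix (Fin m) (Fin m) ℂ →ₗ[ℂ] Matrix (Fin m) (Fin m) ℂ} (h : IsChannel T)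
    {u : Fin m → Fin m → ℂ}
    (hu : ∀ x y, ∑ i, star (u i x) * u i y = if x = y then 1 else 0) :
    m * entanglementFidelity (maxEntangled m) T ≤ ∑ i, pureFidelity T (u i) := by
  have h1 := expectation_sum_le h.choi_posSemidef
    fun i (p : Fin m × Fin m) => star (u i p.1) * u i p.2
  -- The completeness relation `hu` makes the sum of the `ūᵢ ⊗ uᵢ` the unnormalised maximally
  -- entangled vector, whatever the basis.
  have h2 : ∑ i, (fun p : Fin m × Fin m => star (u i p.1) * u i p.2)
      = fun p => if p.1 = p.2 then 1 else 0 := by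
    ext p
    rw [Finset.sum_apply, hu]
  simp only [h2, Fintype.card_fin, ← pureFidelity_eq_expectation_choi] at h1
  rw [entanglementFidelity_maxEntangled]
  have hm' : (0 : ℝ) < m := by exact_mod_cast hm
  rw [sq, mul_inv, mul_assoc, mul_inv_cancel_left₀ hm'.ne', inv_mul_le_iff₀ hm']
  exact h1

theorem sum_star_standardBasis {m : ℕ} (x y : Fin m) :
    ∑ i, star ((Pi.single i (1 : ℂ) : Fin m → ℂ) x) * (Pi.single i (1 : ℂ) : Fin m → ℂ) y
      = if x = y then 1 else 0 := by
  simp [Pi.single_apply, apply_ite, eq_comm]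

theorem isUnitVector_single {n : Type*} [Fintype n] [DecidableEq n] (i : n) :
    IsUnitVector (Pi.single i (1 : ℂ)) := by
  rw [isUnitVector_iff]
  simp

theorem IsChannel.entanglementFidelity_le_one {m : ℕ} (hm : 0 < m)
    {T : Matrix (Fin m) (Fin m) ℂ →ₗ[ℂ] Matrix (Fin m) (Fin m) ℂ} (h : IsChannel T) :
    entanglementFidelity (maxEntangled m) T ≤ 1 := by
  have h1 := h.entanglementFidelity_le_sum hm sum_star_standardBasis
  have h2 := Finset.sum_le_sum fun i (_ : i ∈ Finset.univ) =>
    h.pureFidelity_le_one (isUnitVector_single (n := Fin m) i)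
  rw [Finset.sum_const, Finset.card_univ, Fintype.card_fin, nsmul_eq_mul] at h2
  exact le_of_mul_le_mul_left (h1.trans h2) (by exact_mod_cast hm)

theorem minFidelity_eq_sInf {n : Type*} [Fintype n] [DecidableEq n]
    {T : Matrix n n ℂ →ₗ[ℂ] Matrix n n ℂ} (h : IsChannel T) :
    minFidelity T = sInf (pureFidelity T '' {φ | IsUnitVector φ}) := by
  rw [minFidelity]
  congr 1
  ext f
  constructor
  · rintro ⟨φ, hφ, rfl⟩
    exact ⟨φ, hφ, (fidelity_ketbra_sq (h.posSemidef (ketbra_posSemidef φ)) hφ).symm⟩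
  · rintro ⟨φ, hφ, rfl⟩
    exact ⟨φ, hφ, (fidelity_ketbra_sq (h.posSemidef (ketbra_posSemidef φ)) hφ).symm⟩

theorem IsChannel.minFidelity_le {n : Type*} [Fintype n] [DecidableEq n]
    {T : Matrix n n ℂ →ₗ[ℂ] Matrix n n ℂ} (h : IsChannel T) {u : n → ℂ} (hu : IsUnitVector u) :
    minFidelity T ≤ pureFidelity T u := by
  rw [minFidelity_eq_sInf h]
  refine csInf_le ⟨0, ?_⟩ ⟨u, hu, rfl⟩
  rintro _ ⟨v, -, rfl⟩
  exact h.pureFidelity_nonneg v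

theorem IsChannel.le_minFidelity {n : Type*} [Fintype n] [DecidableEq n] [Nonempty n]
    {T : Matrix n n ℂ →ₗ[ℂ] Matrix n n ℂ} (h : IsChannel T) {c : ℝ}
    (hc : ∀ u, IsUnitVector u → c ≤ pureFidelity T u) : c ≤ minFidelity T := by
  rw [minFidelity_eq_sInf h]
  refine le_csInf ⟨_, _, isUnitVector_single (Classical.arbitrary n), rfl⟩ ?_
  rintro _ ⟨v, hv, rfl⟩
  exact hc v hv

theorem IsChannel.minFidelity_le_one {n : Type*} [Fintype n] [DecidableEq n] [Nonempty n]
    {T : Matrix n n ℂ →ₗ[ℂ] Matrix n n ℂ} (h : IsChannel T) : minFidelity T ≤ 1 :=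
  (h.minFidelity_le (isUnitVector_single (Classical.arbitrary n))).trans
    (h.pureFidelity_le_one (isUnitVector_single _))

/-! ### Averaging over phases -/

/-- The phase average of `uᵢ ū_x ū_j u_y`. -/
theorem sum_phases (m : ℕ) (i x j y : Fin m) :
    ∑ g : Fin m → ZMod 3, ZMod.stdAddChar (g i + g y - g x - g j)
      = (3 : ℂ) ^ m * ((if i = x ∧ j = y then 1 else 0) + (if i = j ∧ x = y then 1 else 0)
        - (if i = x ∧ j = y ∧ i = j then 1 else 0)) := by
  let L : (Fin m → ZMod 3) →+ ZMod 3 :=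
    { toFun := fun g => g i + g y - g x - g j
      map_zero' := by simp
      map_add' := fun g g' => by simp only [Pi.add_apply]; ring }
  have key : ∑ g : Fin m → ZMod 3, ZMod.stdAddChar (g i + g y - g x - g j)
      = if (ZMod.stdAddChar.compAddMonoidHom L : AddChar (Fin m → ZMod 3) ℂ) = 0
        then (Fintype.card (Fin m → ZMod 3) : ℂ) else 0 :=
    AddChar.sum_eq_ite (ZMod.stdAddChar.compAddMonoidHom L : AddChar (Fin m → ZMod 3) ℂ)
  have hcard : (Fintype.card (Fin m → ZMod 3) : ℂ) = 3 ^ m := by simp [ZMod.card]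
  have hzero : (ZMod.stdAddChar.compAddMonoidHom L : AddChar (Fin m → ZMod 3) ℂ) = 0
      ↔ ∀ g : Fin m → ZMod 3, g i + g y - g x - g j = 0 := by
    rw [AddChar.eq_zero_iff]
    refine forall_congr' fun g => ?_
    -- The standard character is injective, so the composite is trivial exactly when the linear form
    -- vanishes.
    rw [AddChar.compAddMonoidHom_apply, ← AddChar.map_zero_eq_one (ZMod.stdAddChar (N := 3)),
      ZMod.injective_stdAddChar.eq_iff]
    rfl
  -- Evaluating on indicator functions forces each plus sign to cancel a minus sign. The pairing `i
  -- = y`, `x = j` alone leaves `2 (g i - g x)`, which is nonzero modulo 3; with signs `±1` it would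
  -- survive.
  have hL : (∀ g : Fin m → ZMod 3, g i + g y - g x - g j = 0)
      ↔ (i = x ∧ j = y) ∨ (i = j ∧ x = y) := by
    constructor
    · intro hg
      have h1 := hg (Pi.single i 1)
      have h2 := hg (Pi.single j 1)
      simp only [Pi.single_apply] at h1 h2
      by_cases hix : x = i
      · subst hix
        refine Or.inl ⟨rfl, ?_⟩
        by_contra hjy
        rw [if_neg (Ne.symm hjy), if_pos trivial] at h2
        split_ifs at h2 <;> exact absurd h2 (by decide)
      · have hij : j = i := by
          by_contra hij
          rw [if_pos trivial, if_neg hix, if_neg hij] at h1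
          split_ifs at h1 <;> exact absurd h1 (by decide)
        subst hij
        refine Or.inr ⟨rfl, ?_⟩
        have h3 := hg (Pi.single x 1)
        simp only [Pi.single_apply] at h3
        by_contra hxy
        rw [if_neg (Ne.symm hix), if_neg (Ne.symm hxy), if_pos trivial] at h3
        exact absurd h3 (by decide)
    · rintro (⟨rfl, rfl⟩ | ⟨rfl, rfl⟩) g <;> ring
  rw [key, hcard]
  simp only [hzero, hL]
  -- Inclusion–exclusion: the subtracted indicator is the overlap of the two pairings.
  have h3 : i = x ∧ j = y ∧ i = j ↔ (i = x ∧ j = y) ∧ (i = j ∧ x = y) := by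
    constructor
    · rintro ⟨rfl, rfl, rfl⟩
      simp
    · rintro ⟨⟨rfl, rfl⟩, rfl, -⟩
      simp
  by_cases h1 : i = x ∧ j = y <;> by_cases h2 : i = j ∧ x = y <;> simp only [h3, h1, h2] <;> simp

theorem pureFidelity_smul {n : Type*} [Fintype n] (T : Matrix n n ℂ →ₗ[ℂ] Matrix n n ℂ) (c : ℝ)
    (u : n → ℂ) : pureFidelity T (fun i => (c : ℂ) * u i) = c ^ 2 * (c ^ 2 * pureFidelity T u) := by
  rw [pureFidelity, ketbra_smul, map_smul, expectation_smul, expectation_smul_vec, pureFidelity]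

theorem IsChannel.trace_choi {n : Type*} [Fintype n] [DecidableEq n]
    {T : Matrix n n ℂ →ₗ[ℂ] Matrix n n ℂ} (h : IsChannel T) :
    ∑ p, choi T p p = Fintype.card n := by
  have h1 : ∀ i : n, ∑ x, choi T (i, x) (i, x) = 1 := fun i =>
    (h.trace_preserving (Matrix.single i i 1)).trans (by simp)
  rw [Fintype.sum_prod_type]
  simp [h1]

/-- The average fidelity of the vectors all of whose coordinates are cube roots of unity. -/
theorem IsChannel.sum_pureFidelity_phases {m : ℕ}
    {T : Matrix (Fin m) (Fin m) ℂ →ₗ[ℂ] Matrix (Fin m) (Fin m) ℂ} (h : IsChannel T) :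
    ∑ g : Fin m → ZMod 3, pureFidelity T (fun i => ZMod.stdAddChar (g i))
      = 3 ^ m * ((expectation (choi T) fun p => if p.1 = p.2 then 1 else 0) + m
        - ∑ i : Fin m, pureFidelity T (Pi.single i 1)) := by
  have h1 : ∀ g : Fin m → ZMod 3, pureFidelity T (fun i => ZMod.stdAddChar (g i))
      = (∑ p : Fin m × Fin m, ∑ q : Fin m × Fin m,
        choi T p q * ZMod.stdAddChar (g p.1 + g q.2 - g p.2 - g q.1)).re := fun g => by
    rw [pureFidelity_eq_expectation_choi, expectation_eq_sum]
    congr 1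
    refine Finset.sum_congr rfl fun p _ => Finset.sum_congr rfl fun q _ => ?_
    simp only [sub_eq_add_neg, AddChar.map_add_eq_mul, AddChar.map_neg_eq_conj, star_mul',
      starRingEnd_apply, star_star]
    ring
  have h2 : ∀ i : Fin m, pureFidelity T (Pi.single i 1) = (choi T (i, i) (i, i)).re := fun i => by
    have h3 : ketbra (Pi.single i (1 : ℂ)) = Matrix.single i i 1 := by
      rw [Matrix.single_eq_single_vecMulVec_single, ketbra, ← Pi.single_star, star_one]
    rw [pureFidelity, h3]
    simp [expectation, choi]
  have h4 : (expectation (choi T) fun p => if p.1 = p.2 then 1 else 0)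
      = (∑ p : Fin m × Fin m, ∑ q : Fin m × Fin m,
        choi T p q * if p.1 = p.2 ∧ q.1 = q.2 then 1 else 0).re := by
    rw [expectation_eq_sum]
    congr 1
    refine Finset.sum_congr rfl fun p _ => Finset.sum_congr rfl fun q _ => ?_
    by_cases hp : p.1 = p.2 <;> by_cases hq : q.1 = q.2 <;> simp [hp, hq]
  -- The pairing `p = q` yields the trace of the Choi matrix; the overlap of the two pairings, in
  -- `h6`, yields the fidelities of the standard basis vectors.
  have h5 : (∑ p : Fin m × Fin m, ∑ q : Fin m × Fin m,
        choi T p q * if p.1 = q.1 ∧ p.2 = q.2 then 1 else 0) = (m : ℂ) := by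
    have := h.trace_choi
    rw [Fintype.card_fin] at this
    rw [← this]
    refine Finset.sum_congr rfl fun p _ => ?_
    simp [← Prod.ext_iff]
  have h6 : (∑ p : Fin m × Fin m, ∑ q : Fin m × Fin m,
        choi T p q * if p.1 = p.2 ∧ q.1 = q.2 ∧ p.1 = q.1 then 1 else 0)
      = ∑ i, choi T (i, i) (i, i) := by
    simp only [Fintype.sum_prod_type]
    refine Finset.sum_congr rfl fun i _ => ?_
    rw [Finset.sum_eq_single i, Finset.sum_eq_single i, Finset.sum_eq_single i]
    · simp
    · intro y _ hy
      simp [Ne.symm hy]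
    · simp
    · intro j _ hj
      simp [Ne.symm hj]
    · simp
    · intro x _ hx
      simp [Ne.symm hx]
    · simp
  have h7 : (∑ g : Fin m → ZMod 3, ∑ p : Fin m × Fin m, ∑ q : Fin m × Fin m,
        choi T p q * ZMod.stdAddChar (g p.1 + g q.2 - g p.2 - g q.1))
      = (3 : ℂ) ^ m * ((∑ p : Fin m × Fin m, ∑ q : Fin m × Fin m,
        choi T p q * if p.1 = p.2 ∧ q.1 = q.2 then 1 else 0) + (m : ℂ)
          - ∑ i, choi T (i, i) (i, i)) := by
    rw [← h5, ← h6, ← Finset.sum_add_distrib, ← Finset.sum_sub_distrib, Finset.mul_sum,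
      Finset.sum_comm]
    refine Finset.sum_congr rfl fun p _ => ?_
    rw [← Finset.sum_add_distrib, ← Finset.sum_sub_distrib, Finset.mul_sum, Finset.sum_comm]
    refine Finset.sum_congr rfl fun q _ => ?_
    rw [← Finset.mul_sum, sum_phases]
    ring
  simp only [h1, h2, h4]
  rw [← Complex.re_sum, ← Complex.re_sum, h7]
  have h8 : ((3 : ℂ) ^ m) = ((3 ^ m : ℝ) : ℂ) := by norm_cast
  rw [h8, Complex.re_ofReal_mul, Complex.sub_re, Complex.add_re, Complex.natCast_re]

/-- Bounding every phase vector and every standard basis vector in the averaging identity below by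
the minimum gives `m² F_min ≤ m² F_e + m - m F_min`. -/
theorem IsChannel.minFidelity_le_entanglementFidelity {m : ℕ} (hm : 0 < m)
    {T : Matrix (Fin m) (Fin m) ℂ →ₗ[ℂ] Matrix (Fin m) (Fin m) ℂ} (h : IsChannel T) :
    2 * minFidelity T - 1 ≤ entanglementFidelity (maxEntangled m) T := by
  have : Nonempty (Fin m) := ⟨⟨0, hm⟩⟩
  have hm' : (1 : ℝ) ≤ m := by exact_mod_cast hm
  have hm0 : (0 : ℝ) < m := by linarith
  have h1 : ∀ g : Fin m → ZMod 3,
      (m : ℝ) ^ 2 * minFidelity T ≤ pureFidelity T (fun i => ZMod.stdAddChar (g i)) := fun g => by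
    -- A phase vector has norm `√m`, and `pureFidelity` is homogeneous of degree four, hence the
    -- factor `m²`.
    have hu : IsUnitVector fun i => (((Real.sqrt m)⁻¹ : ℝ) : ℂ) * ZMod.stdAddChar (g i) := by
      simp [IsUnitVector, inv_pow, AddChar.norm_apply, hm0.ne']
    have h2 := h.minFidelity_le hu
    rw [pureFidelity_smul, inv_pow, Real.sq_sqrt hm0.le, ← mul_assoc, ← mul_inv, ← sq] at h2
    rwa [← le_inv_mul_iff₀ (by positivity)]
  have h2 := Finset.sum_le_sum fun g (_ : g ∈ Finset.univ) => h1 g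
  have h3 := Finset.sum_le_sum fun i (_ : i ∈ Finset.univ) =>
    h.minFidelity_le (isUnitVector_single (n := Fin m) i)
  rw [h.sum_pureFidelity_phases, Finset.sum_const, Finset.card_univ, nsmul_eq_mul] at h2
  rw [Finset.sum_const, Finset.card_univ, nsmul_eq_mul, Fintype.card_fin] at h3
  have hcard : ((Fintype.card (Fin m → ZMod 3) : ℕ) : ℝ) = 3 ^ m := by simp [ZMod.card]
  rw [hcard] at h2
  have h4 := le_of_mul_le_mul_left h2 (by positivity)
  have h5 : (expectation (choi T) fun p => if p.1 = p.2 then 1 else 0)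
      = (m : ℝ) ^ 2 * entanglementFidelity (maxEntangled m) T := by
    rw [entanglementFidelity_maxEntangled, mul_inv_cancel_left₀ (by positivity)]
  rw [h5] at h4
  have h6 := h.minFidelity_le_one
  have h7 : (m : ℝ) * (m * minFidelity T) ≤ m * (m * entanglementFidelity (maxEntangled m) T
      + 1 - minFidelity T) := by linarith
  have h8 := le_of_mul_le_mul_left h7 hm0
  -- From `m (F_min - F_e) ≤ 1 - F_min`, using `m ≥ 1` and `F_min ≤ 1`.
  nlinarith

/-! ### Restricting a code to a subspace -/

/-- For square matrices a left inverse is a right inverse, so orthonormality yields completeness. -/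
theorem OrthonormalBasis.sum_star_mul {m : ℕ}
    (b : OrthonormalBasis (Fin m) ℂ (EuclideanSpace ℂ (Fin m))) (x y : Fin m) :
    ∑ i, star (b i x) * b i y = if x = y then 1 else 0 := by
  have h : (Matrix.of fun i x => star (b i x)) * (Matrix.of fun x i => b i x) = 1 := by
    ext i j
    have := orthonormal_iff_ite.1 b.orthonormal i j
    rw [PiLp.inner_apply] at this
    rw [Matrix.mul_apply, Matrix.one_apply, ← this]
    refine Finset.sum_congr rfl fun x _ => ?_
    simp [mul_comm]
  have h' := congrArg (fun M : Matrix (Fin m) (Fin m) ℂ => M y x) (mul_eq_one_comm.1 h)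
  simp only at h'
  rw [Matrix.mul_apply, Matrix.one_apply] at h'
  rw [← ite_congr (propext (eq_comm (a := y) (b := x))) (fun _ => rfl) (fun _ => rfl), ← h']
  refine Finset.sum_congr rfl fun i _ => ?_
  simp [mul_comm]

theorem isUnitVector_mulVec {m k : Type*} [Fintype m] [Fintype k] [DecidableEq k]
    {V : Matrix m k ℂ} (hV : Vᴴ * V = 1) {ψ : k → ℂ} (hψ : IsUnitVector ψ) :
    IsUnitVector (V *ᵥ ψ) := by
  rw [isUnitVector_iff] at hψ ⊢
  rw [star_mulVec, ← dotProduct_mulVec, mulVec_mulVec, hV, one_mulVec, hψ]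

/-- If every vector of each orthonormal basis has large fidelity on average, then all the
unit vectors of some subspace of at least half the dimension have large fidelity. -/
theorem exists_isometry_of_sum_le {m k : ℕ} (hk : 2 * k ≤ m + 1) {f : (Fin m → ℂ) → ℝ} {η : ℝ}
    (hη : 0 < η)
    (hf : ∀ b : OrthonormalBasis (Fin m) ℂ (EuclideanSpace ℂ (Fin m)),
      ∑ i, (1 - f (b i).ofLp) ≤ m * η)
    (hf1 : ∀ u, IsUnitVector u → f u ≤ 1) :
    ∃ V : Matrix (Fin m) (Fin k) ℂ, Vᴴ * V = 1 ∧
      ∀ ψ, IsUnitVector ψ → 1 - 2 * η ≤ f (V *ᵥ ψ) := by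
  classical
  let bad : OrthonormalBasis (Fin m) ℂ (EuclideanSpace ℂ (Fin m)) → Finset (Fin m) :=
    fun b => Finset.univ.filter fun i => f (b i).ofLp < 1 - 2 * η
  have : Nonempty (OrthonormalBasis (Fin m) ℂ (EuclideanSpace ℂ (Fin m))) :=
    ⟨EuclideanSpace.basisFun (Fin m) ℂ⟩
  -- The count of bad vectors is bounded by `m`, so minimising `m - (bad b).card` over `ℕ` finds a
  -- maximiser.
  obtain ⟨b, hb⟩ : ∃ b, ∀ b', (bad b').card ≤ (bad b).card := by
    refine ⟨Function.argmin fun b => m - (bad b).card, fun b' => ?_⟩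
    have h1 := Function.argmin_le (fun b => m - (bad b).card) b'
    have h2 : (bad b').card ≤ m := (Finset.card_le_univ _).trans (by simp)
    omega
  have hunit : ∀ i, IsUnitVector (b i).ofLp := fun i => by
    have := b.orthonormal.1 i
    rw [IsUnitVector, ← EuclideanSpace.norm_sq_eq, this, one_pow]
  -- Markov's inequality: each bad vector contributes at least `2η` to a sum of nonnegative terms
  -- that is at most `mη`.
  have hcard : 2 * (bad b).card ≤ m := by
    have h1 : ∑ i ∈ bad b, 2 * η ≤ ∑ i, (1 - f (b i).ofLp) := by
      refine (Finset.sum_le_sum (g := fun i => 1 - f (b i).ofLp) fun i hi => ?_).trans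
        (Finset.sum_le_sum_of_subset_of_nonneg (Finset.subset_univ _) fun i _ _ => ?_)
      · have := (Finset.mem_filter.1 hi).2
        linarith
      · linarith [hf1 _ (hunit i)]
    rw [Finset.sum_const, nsmul_eq_mul, ← mul_assoc] at h1
    have h2 := le_of_mul_le_mul_right (h1.trans (hf b)) hη
    have h3 : (2 : ℝ) * (bad b).card ≤ m := by linarith
    exact_mod_cast h3
  have hgood : k ≤ (bad b)ᶜ.card := by
    rw [Finset.card_compl, Fintype.card_fin]
    omega
  let g := (bad b)ᶜ.orderEmbOfCardLe hgood
  have hg : ∀ j, g j ∉ bad b := fun j =>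
    Finset.mem_compl.1 (Finset.orderEmbOfCardLe_mem _ hgood j)
  let V : Matrix (Fin m) (Fin k) ℂ := Matrix.of fun x j => b (g j) x
  have hV : Vᴴ * V = 1 := by
    ext i j
    have := orthonormal_iff_ite.1 b.orthonormal (g i) (g j)
    simp only [PiLp.inner_apply, g.injective.eq_iff] at this
    rw [Matrix.mul_apply, Matrix.one_apply, ← this]
    refine Finset.sum_congr rfl fun x _ => ?_
    simp [V, mul_comm]
  refine ⟨V, hV, fun ψ hψ => ?_⟩
  by_contra! hlt
  have hk0 : 0 < k := by
    rcases Nat.eq_zero_or_pos k with rfl | h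
    · simp [IsUnitVector] at hψ
    · exact h
  let i₀ := g ⟨0, hk0⟩
  let φ : EuclideanSpace ℂ (Fin m) := WithLp.toLp 2 (V *ᵥ ψ)
  have hφ : φ = ∑ j, ψ j • b (g j) := by
    ext x
    simp [φ, V, mulVec, dotProduct, mul_comm]
  have hφ1 : ‖φ‖ = 1 := by
    have := isUnitVector_mulVec hV hψ
    rw [IsUnitVector] at this
    have h2 : ‖φ‖ ^ 2 = 1 := by rw [EuclideanSpace.norm_sq_eq]; exact this
    exact (pow_eq_one_iff_of_nonneg (norm_nonneg φ) two_ne_zero).1 h2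
  have hperp : ∀ i ∈ bad b, inner ℂ (b i) φ = 0 := fun i hi => by
    rw [hφ, inner_sum]
    refine Finset.sum_eq_zero fun j _ => ?_
    have hij : i ≠ g j := fun h => hg j (h ▸ hi)
    rw [inner_smul_right, b.orthonormal.2 hij, mul_zero]
  -- A bad `φ` in the span of the good vectors is orthogonal to all bad ones. Putting it at the good
  -- index `i₀` and completing to a basis yields one more bad vector than the maximum.
  let v := Function.update b i₀ φ
  have hv0 : v i₀ = φ := Function.update_self ..
  have hv : ∀ i ∈ bad b, v i = b i := fun i hi =>
    Function.update_of_ne (fun h => hg _ (h ▸ hi)) ..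
  let s : Set (Fin m) := insert i₀ (bad b : Set (Fin m))
  have hs : Orthonormal ℂ (s.domRestrict v) := by
    constructor
    · rintro ⟨i, rfl | hi⟩
      · exact (congrArg norm hv0).trans hφ1
      · exact (congrArg norm (hv i hi)).trans (b.orthonormal.1 i)
    · rintro ⟨i, hi⟩ ⟨j, hj⟩ hij
      have hij' : i ≠ j := fun h => hij (Subtype.ext h)
      change inner ℂ (v i) (v j) = 0
      rcases hi with rfl | hi <;> rcases hj with rfl | hj
      · exact absurd rfl hij'
      · rw [hv0, hv j hj, inner_eq_zero_symm, hperp j hj]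
      · rw [hv0, hv i hi, hperp i hi]
      · rw [hv i hi, hv j hj, b.orthonormal.2 hij']
  obtain ⟨b', hb'⟩ := hs.exists_orthonormalBasis_extension_of_card_eq (by simp)
  have hsub : insert i₀ (bad b) ⊆ bad b' := by
    intro i hi
    rcases Finset.mem_insert.1 hi with rfl | hi
    · refine Finset.mem_filter.2 ⟨Finset.mem_univ _, ?_⟩
      rw [hb' _ (Set.mem_insert _ _), hv0]
      exact hlt
    · refine Finset.mem_filter.2 ⟨Finset.mem_univ _, ?_⟩
      rw [hb' _ (Set.mem_insert_of_mem _ hi), hv i hi]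
      exact (Finset.mem_filter.1 hi).2
  have h1 := Finset.card_le_card hsub
  rw [Finset.card_insert_of_notMem (hg _)] at h1
  exact absurd (hb b') (by omega)

theorem ketbra_mulVec {m k : Type*} [Fintype k] (V : Matrix m k ℂ) (ψ : k → ℂ) :
    V * ketbra ψ * Vᴴ = ketbra (V *ᵥ ψ) := by
  rw [ketbra, mul_vecMulVec, vecMulVec_mul, ketbra, star_mulVec]

theorem expectation_conjTranspose_mul_mul {m k : Type*} [Fintype m] [Fintype k]
    (V : Matrix m k ℂ) (M : Matrix m m ℂ) (ψ : k → ℂ) :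
    expectation (Vᴴ * M * V) ψ = expectation M (V *ᵥ ψ) := by
  rw [expectation, expectation, star_mulVec, ← dotProduct_mulVec, mulVec_mulVec, mulVec_mulVec,
    Matrix.mul_assoc]

/-- The Kraus operators of the channel that compresses to the range of the isometry `V` and
prepares a fixed state when the compression fails. -/
def compressionKraus {m k : Type*} [Fintype m] [Fintype k] [DecidableEq m] [DecidableEq k]
    (V : Matrix m k ℂ) (x₀ : k) : Option m → Matrix k m ℂ
  | none => Vᴴ
  | some j => Matrix.single x₀ j (1 : ℂ) * (1 - V * Vᴴ)

/-- As `V` is an isometry, `V Vᴴ` is a projection; the failure branch contributes exactly the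
complementary projection to the sum of the `Kᴴ K`. -/
theorem isChannel_compression {m k : Type*} [Fintype m] [Fintype k] [DecidableEq m]
    [DecidableEq k] {V : Matrix m k ℂ} (hV : Vᴴ * V = 1) (x₀ : k) :
    IsChannel (krausMap (compressionKraus V x₀)) := by
  refine isChannel_krausMap _ ?_
  have h1 : (1 - V * Vᴴ) * (1 - V * Vᴴ) = 1 - V * Vᴴ := by
    have : V * Vᴴ * (V * Vᴴ) = V * Vᴴ := by
      rw [Matrix.mul_assoc, ← Matrix.mul_assoc Vᴴ, hV, Matrix.one_mul]
    simp [Matrix.mul_sub, Matrix.sub_mul, this]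
  have h2 : ∑ j : m, (Matrix.single x₀ j (1 : ℂ))ᴴ * Matrix.single x₀ j (1 : ℂ) = 1 := by
    ext x y
    simp [Matrix.sum_apply, Matrix.single_apply, Matrix.one_apply, ite_and]
  have h3 : ∀ j, (compressionKraus V x₀ (some j))ᴴ * compressionKraus V x₀ (some j)
      = (1 - V * Vᴴ) * ((Matrix.single x₀ j (1 : ℂ))ᴴ * Matrix.single x₀ j (1 : ℂ))
        * (1 - V * Vᴴ) := fun j => by
    simp only [compressionKraus, conjTranspose_mul, conjTranspose_sub, conjTranspose_one,
      conjTranspose_conjTranspose, Matrix.mul_assoc]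
  rw [Fintype.sum_option, Finset.sum_congr rfl fun j _ => h3 j, ← Finset.sum_mul,
    ← Finset.mul_sum, h2, Matrix.mul_one, h1]
  simp [compressionKraus]

/-- Restricting the input of a channel to a subspace and compressing its output to that subspace
does not decrease the fidelities of the vectors in the subspace. -/
theorem IsChannel.pureFidelity_le_compression {m k : Type*} [Fintype m] [Fintype k]
    [DecidableEq m] [DecidableEq k] {T : Matrix m m ℂ →ₗ[ℂ] Matrix m m ℂ} (h : IsChannel T)
    (V : Matrix m k ℂ) (x₀ : k) (ψ : k → ℂ) :
    pureFidelity T (V *ᵥ ψ) ≤ pureFidelity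
      (krausMap (compressionKraus V x₀) ∘ₗ T ∘ₗ krausMap fun _ : Unit => V) ψ := by
  have hT := h.posSemidef (ketbra_posSemidef (V *ᵥ ψ))
  rw [pureFidelity, pureFidelity, LinearMap.comp_apply, LinearMap.comp_apply,
    krausMap_apply (fun _ : Unit => V), Fintype.sum_unique, ketbra_mulVec, krausMap_apply,
    Fintype.sum_option, expectation_add]
  have h1 : expectation (compressionKraus V x₀ none * T (ketbra (V *ᵥ ψ)) *
      (compressionKraus V x₀ none)ᴴ) ψ = expectation (T (ketbra (V *ᵥ ψ))) (V *ᵥ ψ) := by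
    rw [← expectation_conjTranspose_mul_mul]
    simp [compressionKraus]
  rw [h1]
  -- The successful branch alone reproduces the old fidelity; the failure branch only adds a
  -- nonnegative term.
  exact le_add_of_nonneg_right (expectation_nonneg
    (posSemidef_sum _ fun j _ => hT.mul_mul_conjTranspose_same _) ψ)

/-- The isometry acts on `A₀` only and leaves the shared state untouched, so the sender can absorb
it into the encoding with the same `d`. -/
theorem assistedEncoding_comp_krausMap {a : Type*} {m k d : ℕ}
    (E : Matrix (Fin m × Fin d) (Fin m × Fin d) ℂ →ₗ[ℂ] Matrix a a ℂ)
    (V : Matrix (Fin m) (Fin k) ℂ) :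
    assistedEncoding (E ∘ₗ krausMap fun _ : Unit => V ⊗ₖ (1 : Matrix (Fin d) (Fin d) ℂ))
      = assistedEncoding E ∘ₗ krausMap fun _ : Unit => V := by
  refine LinearMap.ext fun ρ => ?_
  ext p q
  have h : ∀ (n : ℕ) (σ : Matrix (Fin n) (Fin n) ℂ)
      (E' : Matrix (Fin n × Fin d) (Fin n × Fin d) ℂ →ₗ[ℂ] Matrix a a ℂ),
      assistedEncoding E' σ p q = E' (σ ⊗ₖ Matrix.of fun x y =>
        ketbra (maxEntangled d) (x, p.2) (y, q.2)) p.1 q.1 := fun n σ E' => rfl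
  rw [h, LinearMap.comp_apply, LinearMap.comp_apply, h, krausMap_apply, krausMap_apply,
    Fintype.sum_unique, Fintype.sum_unique, conjTranspose_kronecker, conjTranspose_one,
    ← mul_kronecker_mul, ← mul_kronecker_mul, Matrix.one_mul, Matrix.mul_one]

/-! ### Comparison of the capacities -/

/-- From a code of dimension `m` with entanglement fidelity at least `1 - η`, one of dimension
`⌈m / 2⌉` with minimum output fidelity at least `1 - 2η`. -/
theorem exists_code_minFidelity {a b : Type*} [Fintype a] [Fintype b] {m k d : ℕ} (hk0 : 0 < k)
    (hk : 2 * k ≤ m + 1) (hd : 0 < d) {N : Matrix a a ℂ →ₗ[ℂ] Matrix b b ℂ}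
    {E : Matrix (Fin m × Fin d) (Fin m × Fin d) ℂ →ₗ[ℂ] Matrix a a ℂ}
    {D : Matrix (b × Fin d) (b × Fin d) ℂ →ₗ[ℂ] Matrix (Fin m) (Fin m) ℂ}
    (hN : IsChannel N) (hE : IsChannel E) (hD : IsChannel D) {η : ℝ} (hη : 0 < η)
    (hF : 1 - η ≤ entanglementFidelity (maxEntangled m) (protocol N E D)) :
    ∃ (E' : Matrix (Fin k × Fin d) (Fin k × Fin d) ℂ →ₗ[ℂ] Matrix a a ℂ)
      (D' : Matrix (b × Fin d) (b × Fin d) ℂ →ₗ[ℂ] Matrix (Fin k) (Fin k) ℂ),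
      IsChannel E' ∧ IsChannel D' ∧ 1 - 2 * η ≤ minFidelity (protocol N E' D') := by
  have hm : 0 < m := by omega
  have hT := IsChannel.protocol hd hN hE hD
  have hsum : ∀ u : OrthonormalBasis (Fin m) ℂ (EuclideanSpace ℂ (Fin m)),
      ∑ i, (1 - pureFidelity (protocol N E D) (u i).ofLp) ≤ m * η := fun u => by
    have h1 := hT.entanglementFidelity_le_sum hm (u := fun i => (u i).ofLp)
      (OrthonormalBasis.sum_star_mul u)
    have h2 := mul_le_mul_of_nonneg_left hF (Nat.cast_nonneg (α := ℝ) m)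
    rw [Finset.sum_sub_distrib, Finset.sum_const, Finset.card_univ, Fintype.card_fin, nsmul_eq_mul]
    linarith
  obtain ⟨V, hV, hVf⟩ := exists_isometry_of_sum_le hk hη hsum fun u => hT.pureFidelity_le_one
  let x₀ : Fin k := ⟨0, hk0⟩
  have : Nonempty (Fin k) := ⟨x₀⟩
  have hE' : IsChannel (E ∘ₗ krausMap fun _ : Unit => V ⊗ₖ (1 : Matrix (Fin d) (Fin d) ℂ)) := by
    refine hE.comp (isChannel_krausMap _ ?_)
    rw [Fintype.sum_unique, conjTranspose_kronecker, ← mul_kronecker_mul, hV, conjTranspose_one,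
      Matrix.one_mul, one_kronecker_one]
  have hD' := (isChannel_compression hV x₀).comp hD
  refine ⟨_, _, hE', hD', (IsChannel.protocol hd hN hE' hD').le_minFidelity fun ψ hψ => ?_⟩
  refine (hVf ψ hψ).trans ((hT.pureFidelity_le_compression V x₀ ψ).trans (le_of_eq ?_))
  rw [protocol, protocol, assistedEncoding_comp_krausMap]
  rfl

theorem le_transmissionFidelity {a b : Type*} [Fintype a] [Fintype b] {m d : ℕ} (hm : 0 < m)
    (hd : 0 < d) {N : Matrix a a ℂ →ₗ[ℂ] Matrix b b ℂ}
    {E : Matrix (Fin m × Fin d) (Fin m × Fin d) ℂ →ₗ[ℂ] Matrix a a ℂ}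
    {D : Matrix (b × Fin d) (b × Fin d) ℂ →ₗ[ℂ] Matrix (Fin m) (Fin m) ℂ}
    (hN : IsChannel N) (hE : IsChannel E) (hD : IsChannel D) :
    entanglementFidelity (maxEntangled m) (protocol N E D) ≤ transmissionFidelity N m := by
  refine le_csSup ⟨1, ?_⟩ ⟨d, hd, E, D, hE, hD, rfl⟩
  rintro _ ⟨d, hd, E, D, hE, hD, rfl⟩
  exact (IsChannel.protocol hd hN hE hD).entanglementFidelity_le_one hm

theorem le_minOutputFidelity {a b : Type*} [Fintype a] [Fintype b] {m d : ℕ} (hm : 0 < m)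
    (hd : 0 < d) {N : Matrix a a ℂ →ₗ[ℂ] Matrix b b ℂ}
    {E : Matrix (Fin m × Fin d) (Fin m × Fin d) ℂ →ₗ[ℂ] Matrix a a ℂ}
    {D : Matrix (b × Fin d) (b × Fin d) ℂ →ₗ[ℂ] Matrix (Fin m) (Fin m) ℂ}
    (hN : IsChannel N) (hE : IsChannel E) (hD : IsChannel D) :
    minFidelity (protocol N E D) ≤ minOutputFidelity N m := by
  have : Nonempty (Fin m) := ⟨⟨0, hm⟩⟩
  refine le_csSup ⟨1, ?_⟩ ⟨d, hd, E, D, hE, hD, rfl⟩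
  rintro _ ⟨d, hd, E, D, hE, hD, rfl⟩
  exact (IsChannel.protocol hd hN hE hD).minFidelity_le_one

theorem transmissionFidelity_nonneg {a b : Type*} [Fintype a] [Fintype b]
    {N : Matrix a a ℂ →ₗ[ℂ] Matrix b b ℂ} (hN : IsChannel N) (m : ℕ) :
    0 ≤ transmissionFidelity N m := by
  refine Real.sSup_nonneg ?_
  rintro _ ⟨d, hd, E, D, hE, hD, rfl⟩
  exact (IsChannel.protocol hd hN hE hD).entanglementFidelity_nonneg

theorem minOutputFidelity_le_transmissionFidelity {a b : Type*} [Fintype a] [Fintype b]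
    {N : Matrix a a ℂ →ₗ[ℂ] Matrix b b ℂ} (hN : IsChannel N) {m : ℕ} (hm : 0 < m) :
    2 * minOutputFidelity N m - 1 ≤ transmissionFidelity N m := by
  have h : minOutputFidelity N m ≤ (transmissionFidelity N m + 1) / 2 := by
    -- The bound must be nonnegative because an empty supremum is `0` by convention; this avoids
    -- exhibiting a code.
    refine Real.sSup_le ?_ (by linarith [transmissionFidelity_nonneg hN m])
    rintro _ ⟨d, hd, E, D, hE, hD, rfl⟩
    have h1 := (IsChannel.protocol hd hN hE hD).minFidelity_le_entanglementFidelity hm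
    linarith [le_transmissionFidelity hm hd hN hE hD]
  linarith

/-- The supremum need not be attained, so the estimate for a single code is applied with arbitrarily
small slack `δ`. -/
theorem transmissionFidelity_le_minOutputFidelity {a b : Type*} [Fintype a] [Fintype b]
    {N : Matrix a a ℂ →ₗ[ℂ] Matrix b b ℂ} (hN : IsChannel N) {m k : ℕ} (hk0 : 0 < k)
    (hk : 2 * k ≤ m + 1) {ε : ℝ} (hε0 : 0 < ε) (hε1 : ε < 1)
    (h : 1 - ε ≤ transmissionFidelity N m) : 1 - 2 * ε ≤ minOutputFidelity N k := by
  refine le_of_forall_pos_le_add fun δ hδ => ?_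
  have hne : {f : ℝ | ∃ d : ℕ, 0 < d ∧
      ∃ (E : Matrix (Fin m × Fin d) (Fin m × Fin d) ℂ →ₗ[ℂ] Matrix a a ℂ)
        (D : Matrix (b × Fin d) (b × Fin d) ℂ →ₗ[ℂ] Matrix (Fin m) (Fin m) ℂ),
        IsChannel E ∧ IsChannel D ∧
          f = entanglementFidelity (maxEntangled m) (protocol N E D)}.Nonempty := by
    -- An empty set would have supremum `0`, contradicting `1 - ε > 0`.
    by_contra hempty
    rw [Set.not_nonempty_iff_eq_empty] at hempty
    rw [transmissionFidelity, hempty, Real.sSup_empty] at h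
    linarith
  -- Half of `δ`, since passing to the subspace doubles the error.
  have hlt : 1 - (ε + δ / 2) < transmissionFidelity N m := by linarith
  obtain ⟨_, ⟨d, hd, E, D, hE, hD, rfl⟩, hF⟩ := exists_lt_of_lt_csSup hne hlt
  obtain ⟨E', D', hE', hD', hF'⟩ :=
    exists_code_minFidelity hk0 hk hd hN hE hD (by linarith) hF.le
  linarith [le_minOutputFidelity hk0 hd hN hE' hD']

end

end EAQ

theorem mainTheorem2 {a b : Type*} [Fintype a] [Fintype b] [Nonempty a]
    (N : Matrix a a ℂ →ₗ[ℂ] Matrix b b ℂ) (hN : EAQ.IsChannel N)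
    (ε : ℝ) (hε0 : 0 < ε) (hε1 : ε < 1) :
    EAQ.entanglementTransmissionCapacity N ε - 1 ≤ EAQ.quantumCapacity N (2 * ε) ∧
      EAQ.quantumCapacity N (2 * ε) ≤ EAQ.entanglementTransmissionCapacity N (4 * ε) := by
  constructor
  · refine EReal.sub_le_of_le_add (sSup_le ?_)
    rintro _ ⟨m, hm, hF, rfl⟩
    -- The new dimension is `⌈m/2⌉`; rounding up gives `m ≤ 2⌈m/2⌉`, so at most one qubit is lost
    -- even for odd `m`.
    have hk0 : 0 < (m + 1) / 2 := by omega
    have h1 := EAQ.transmissionFidelity_le_minOutputFidelity hN hk0 (by omega) hε0 hε1 hF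
    have h2 : ((Real.logb 2 ((m + 1) / 2 : ℕ) : ℝ) : EReal) ≤ EAQ.quantumCapacity N (2 * ε) :=
      le_sSup ⟨_, hk0, h1, rfl⟩
    have h3 : Real.logb 2 m ≤ Real.logb 2 ((m + 1) / 2 : ℕ) + 1 := by
      have hk0' : (0 : ℝ) < ((m + 1) / 2 : ℕ) := by exact_mod_cast hk0
      have h4 : (m : ℝ) ≤ ((m + 1) / 2 : ℕ) * 2 := by
        have : m ≤ (m + 1) / 2 * 2 := by omega
        exact_mod_cast this
      have h5 : Real.logb 2 ((m + 1) / 2 : ℕ) + 1 = Real.logb 2 (((m + 1) / 2 : ℕ) * 2) := by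
        rw [Real.logb_mul hk0'.ne' two_ne_zero, Real.logb_self_eq_one one_lt_two]
      rw [h5]
      exact Real.logb_le_logb_of_le one_lt_two (by exact_mod_cast hm) h4
    calc ((Real.logb 2 m : ℝ) : EReal)
        ≤ ((Real.logb 2 ((m + 1) / 2 : ℕ) + 1 : ℝ) : EReal) := EReal.coe_le_coe_iff.2 h3
      _ = ((Real.logb 2 ((m + 1) / 2 : ℕ) : ℝ) : EReal) + 1 := by
        rw [EReal.coe_add, EReal.coe_one]
      _ ≤ _ := add_le_add_left h2 1
  · refine sSup_le_sSup ?_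
    rintro _ ⟨m, hm, hF, rfl⟩
    refine ⟨m, hm, ?_, rfl⟩
    -- The constant comes from `2 (1 - 2ε) - 1 = 1 - 4ε`.
    linarith [EAQ.minOutputFidelity_le_transmissionFidelity hN hm]
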